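/- Let $\mathcal H$ be a complex Hilbert space of finite dimension $n\ge 3$. Let $\mathcal P(\mathcal H)$ be the set of orthogonal projections on $\mathcal H$ and $\mathcal P_1(\mathcal H)$ the set of those of rank one. The joint spectrum of operators $A_1,\dots,A_k\in\mathcal B(\mathcal H)$ is $$\sigma([A_1,\dots,A_k])=\{(c_1,\dots,c_k)\in\mathbb C^k : c_1A_1+\dots+c_kA_k \text{ is not invertible in } \mathcal B(\mathcal H)\},$$ and a map $\psi$ from a set $S\subseteq\mathcal B(\mathcal H)$ to itself is said to preserve the joint spectrum of any $k$ members of $S$ if $\sigma([\psi(P_1),\dots,\psi(P_k)])=\sigma([P_1,\dots,P_k])$ for all $P_1,\dots,P_k\in S$. Let $\phi:\mathcal P_1(\mathcal H)\to\mathcal P_1(\mathcal H)$ be a surjective map. Then the following are equivalent. 1. $\phi$ preserves the joint spectrum of any $n$ rank one projections. 2. There exist an orthonormal basis $\alpha_1,\dots,\alpha_n$ of $\mathcal H$, a basis $\beta_1,\dots,\beta_n$ of $\mathcal H$ and a ring automorphism $f$ of $\mathbb C$ such that $$\phi(P)(\mathcal H)=\{\hat f(P\xi) : \xi\in\mathcal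 H\}\quad\text{for all } P\in\mathcal P_1(\mathcal H),$$ where $\hat f:\mathcal H\to\mathcal H$ is given by $\hat f(z_1\alpha_1+\dots+z_n\alpha_n)=f(z_1)\beta_1+\dots+f(z_n)\beta_n$. 3. $\phi$ extends to a surjective map $\Phi:\mathcal P(\mathcal H)\to\mathcal P(\mathcal H)$ that preserves the joint spectrum of any two projections. -/

import Mathlib

/-- The joint spectrum of a tuple `A` of bounded operators on `H`: the set of coefficient vectors `c`
for which the linear combination `∑ i, c i • A i` is not invertible in the algebra of bounded
operators. -/
def jointSpectrum {H : Type*} [NormedAddCommGroup H] [InnerProductSpace ℂ H] {k : ℕ}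
    (A : Fin k → (H →L[ℂ] H)) : Set (Fin k → ℂ) :=
  {c | ¬ IsUnit (∑ i, c i • A i)}

/-- The set of (orthogonal) projections on `H`. -/
def projections (H : Type*) [NormedAddCommGroup H] [InnerProductSpace ℂ H] [CompleteSpace H] :
    Set (H →L[ℂ] H) :=
  {P | IsStarProjection P}

/-- The set of rank one projections on `H`. -/
def rankOneProjections (H : Type*) [NormedAddCommGroup H] [InnerProductSpace ℂ H]
    [CompleteSpace H] : Set (H →L[ℂ] H) :=
  {P | IsStarProjection P ∧ Module.finrank ℂ (LinearMap.range (P : H →ₗ[ℂ] H)) = 1}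

/-- A map `φ` of a set `S` of operators into itself preserves the joint spectrum of any `k` members
of `S` (repetitions allowed). -/
def PreservesJointSpectrum {H : Type*} [NormedAddCommGroup H] [InnerProductSpace ℂ H]
    (k : ℕ) {S : Set (H →L[ℂ] H)} (φ : S → S) : Prop :=
  ∀ P : Fin k → S,
    jointSpectrum (fun i => (φ (P i) : H →L[ℂ] H)) = jointSpectrum (fun i => (P i : H →L[ℂ] H))

/-- The map `f̂ : H → H` induced by a ring automorphism `f` of `ℂ`, an orthonormal basis `α` and a
basis `β`, which sends `∑ i, z i • α i` to `∑ i, f (z i) • β i`. -/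
noncomputable def inducedMap {H : Type*} [NormedAddCommGroup H] [InnerProductSpace ℂ H] {n : ℕ}
    (α : OrthonormalBasis (Fin n) ℂ H) (β : Module.Basis (Fin n) ℂ H) (f : ℂ ≃+* ℂ) (x : H) : H :=
  ∑ i, f (α.repr x i) • β i

/-! ### Fundamental theorem of projective geometry in coordinates. -/

section Coordinates

variable {K ι : Type*} [Field K] [Fintype ι] [DecidableEq ι]

/-! A combination of n rank one projections is invertible exactly when all coefficients are nonzero
and the n lines span (`isUnit_sum_smul_iff`). So condition 1 says that φ preserves and reflects
linear independence of n-tuples of lines, and condition 2 follows from the fundamental theorem of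
projective geometry (`exists_ringEquiv_of_linearIndependent_iff`). That theorem is proved by padding
three vectors with standard basis vectors, so that independence becomes nonvanishing of a 3 × 3
minor; suitable minors show that coordinate ratios transform by a single field automorphism.

A semilinear bijection acts on subspaces as an order isomorphism. For two projections, invertibility
of a combination depends only on the coefficients and on joins, meets, top and bottom of the ranges
(`isUnit_smul_add_smul_iff`), which gives 2 → 3. For 3 → 1, the coefficients (1, 1) show that Φ
preserves spanning pairs of subspaces; these determine the order (`le_iff_forall_sup_eq_top`), so Φ
is an order isomorphism on ranges and preserves n-fold joins. -/

/-- A square family whose members outside three indices are multiples of the standard basis vectors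
is linearly independent iff the corresponding `3 × 3` minor is nonzero. -/
theorem linearIndependent_iff_det_three_ne_zero {i j k : ι} (hij : i ≠ j) (hik : i ≠ k)
    (hjk : j ≠ k) (v : ι → ι → K)
    (hv : ∀ l, l ≠ i → l ≠ j → l ≠ k → ∃ c : K, c ≠ 0 ∧ v l = c • Pi.single l 1) :
    LinearIndependent K v ↔
      (!![v i i, v i j, v i k; v j i, v j j, v j k; v k i, v k j, v k k]).det ≠ 0 := by
  have hsum : ∀ w : ι → K, (∀ l, l ≠ i → l ≠ j → l ≠ k → w l = 0) → ∀ u : ι → K,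
      u ⬝ᵥ w = u i * w i + (u j * w j + u k * w k) := by
    intro w hw u
    have : u ⬝ᵥ w = ∑ l ∈ {i, j, k}, u l * w l := by
      refine (Finset.sum_subset (Finset.subset_univ _) fun l _ hl => ?_).symm
      simp only [Finset.mem_insert, Finset.mem_singleton, not_or] at hl
      rw [hw l hl.1 hl.2.1 hl.2.2, mul_zero]
    rw [this, Finset.sum_insert (by simp [hij, hik]), Finset.sum_insert (by simp [hjk]),
      Finset.sum_singleton]
  have h1 : LinearIndependent K v ↔ IsUnit (Matrix.of v) :=
    Matrix.linearIndependent_rows_iff_isUnit (A := Matrix.of v)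
  rw [h1, Matrix.isUnit_iff_isUnit_det, isUnit_iff_ne_zero, not_iff_not,
    ← Matrix.exists_mulVec_eq_zero_iff, ← Matrix.exists_mulVec_eq_zero_iff]
  constructor
  · rintro ⟨w, hw0, hw⟩
    have hwl : ∀ l, l ≠ i → l ≠ j → l ≠ k → w l = 0 := by
      intro l h1 h2 h3
      obtain ⟨c, hc, hvl⟩ := hv l h1 h2 h3
      have := congrFun hw l
      change v l ⬝ᵥ w = 0 at this
      rw [hvl, smul_dotProduct, single_one_dotProduct, smul_eq_mul] at this
      exact (mul_eq_zero.1 this).resolve_left hc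
    refine ⟨![w i, w j, w k], fun h => hw0 ?_, ?_⟩
    · ext l
      by_cases h1 : l = i
      · subst h1; simpa using congrFun h 0
      by_cases h2 : l = j
      · subst h2; simpa using congrFun h 1
      by_cases h3 : l = k
      · subst h3; simpa using congrFun h 2
      exact hwl l h1 h2 h3
    · have h := fun l => (hsum w hwl (v l)).symm.trans (congrFun hw l)
      ext a
      fin_cases a
      · simpa [Matrix.mulVec, dotProduct, Fin.sum_univ_three, add_assoc] using h i
      · simpa [Matrix.mulVec, dotProduct, Fin.sum_univ_three, add_assoc] using h j
      · simpa [Matrix.mulVec, dotProduct, Fin.sum_univ_three, add_assoc] using h k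
  · rintro ⟨u, hu0, hu⟩
    set w : ι → K := fun l => if l = i then u 0 else if l = j then u 1 else if l = k then u 2 else 0
      with hwdef
    have hwi : w i = u 0 := by simp [hwdef]
    have hwj : w j = u 1 := by simp [hwdef, hij.symm]
    have hwk : w k = u 2 := by simp [hwdef, hik.symm, hjk.symm]
    have hwl : ∀ l, l ≠ i → l ≠ j → l ≠ k → w l = 0 := by
      intro l h1 h2 h3
      simp [hwdef, h1, h2, h3]
    refine ⟨w, fun h => hu0 ?_, ?_⟩
    · ext a
      fin_cases a
      · simpa [hwi] using congrFun h i
      · simpa [hwj] using congrFun h j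
      · simpa [hwk] using congrFun h k
    · ext l
      change v l ⬝ᵥ w = 0
      rw [hsum w hwl (v l), hwi, hwj, hwk]
      by_cases h1 : l = i
      · subst h1
        simpa [Matrix.mulVec, dotProduct, Fin.sum_univ_three, add_assoc] using congrFun hu 0
      by_cases h2 : l = j
      · subst h2
        simpa [Matrix.mulVec, dotProduct, Fin.sum_univ_three, add_assoc] using congrFun hu 1
      by_cases h3 : l = k
      · subst h3
        simpa [Matrix.mulVec, dotProduct, Fin.sum_univ_three, add_assoc] using congrFun hu 2
      obtain ⟨c, hc, hvl⟩ := hv l h1 h2 h3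
      simp [hvl, Ne.symm h1, Ne.symm h2, Ne.symm h3]

/-- A map of `K ^ ι` which preserves and reflects linear independence of `ι`-indexed families and
fixes the standard basis vectors up to scalars preserves vanishing of `3 × 3` minors. -/
theorem det_three_eq_zero_iff_of_linearIndependent_iff {G : (ι → K) → ι → K}
    (hG : ∀ v : ι → ι → K, LinearIndependent K (G ∘ v) ↔ LinearIndependent K v)
    (hGs : ∀ i, ∃ c : K, c ≠ 0 ∧ G (Pi.single i 1) = c • Pi.single i 1)
    {i j k : ι} (hij : i ≠ j) (hik : i ≠ k) (hjk : j ≠ k) (x y z : ι → K) :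
    (!![G x i, G x j, G x k; G y i, G y j, G y k; G z i, G z j, G z k]).det = 0 ↔
      (!![x i, x j, x k; y i, y j, y k; z i, z j, z k]).det = 0 := by
  set v : ι → ι → K := fun l => if l = i then x else if l = j then y else if l = k then z else
    Pi.single l 1 with hv
  have hi : v i = x := by simp [hv]
  have hj : v j = y := by simp [hv, hij.symm]
  have hk : v k = z := by simp [hv, hik.symm, hjk.symm]
  have hl : ∀ l, l ≠ i → l ≠ j → l ≠ k → v l = Pi.single l 1 := by
    intro l h1 h2 h3
    simp [hv, h1, h2, h3]
  have h1 := linearIndependent_iff_det_three_ne_zero hij hik hjk v fun l h1 h2 h3 =>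
    ⟨1, one_ne_zero, by rw [one_smul, hl l h1 h2 h3]⟩
  have h2 := linearIndependent_iff_det_three_ne_zero hij hik hjk (G ∘ v) fun l h1 h2 h3 => by
    simpa [hl l h1 h2 h3] using hGs l
  rw [hG, h1] at h2
  simpa only [Function.comp, hi, hj, hk, not_iff_not, ne_eq] using h2.symm

theorem exists_ne_and_ne_of_three_le_card (hι : 3 ≤ Fintype.card ι) (i j : ι) :
    ∃ k, k ≠ i ∧ k ≠ j := by
  have : ({i, j} : Finset ι).card < Fintype.card ι := Finset.card_le_two.trans_lt hι
  obtain ⟨k, hk⟩ := Finset.exists_mem_notMem_of_card_lt_card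
    (this.trans_eq Finset.card_univ.symm)
  exact ⟨k, by simpa using hk⟩

/-- Taking a standard basis vector at a third index as the third row collapses the 3 × 3 minor to a
2 × 2 one. -/
theorem minor_eq_iff_of_linearIndependent_iff (hι : 3 ≤ Fintype.card ι) {G : (ι → K) → ι → K}
    (hG : ∀ v : ι → ι → K, LinearIndependent K (G ∘ v) ↔ LinearIndependent K v)
    (hGs : ∀ i, ∃ c : K, c ≠ 0 ∧ G (Pi.single i 1) = c • Pi.single i 1) {i j : ι} (hij : i ≠ j)
    (x y : ι → K) : G x i * G y j = G x j * G y i ↔ x i * y j = x j * y i := by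
  obtain ⟨k, hki, hkj⟩ := exists_ne_and_ne_of_three_le_card hι i j
  obtain ⟨c, hc, hGk⟩ := hGs k
  have := det_three_eq_zero_iff_of_linearIndependent_iff hG hGs hij hki.symm hkj.symm x y
    (Pi.single k 1)
  rw [hGk] at this
  simp [Matrix.det_fin_three, hki.symm, hkj.symm] at this
  rw [← sub_mul, mul_eq_zero, or_iff_left hc] at this
  rw [← sub_eq_zero, this, sub_eq_zero]

/-- Against a standard basis vector at another index, the 2 × 2 minor reduces to the single
coordinate `x i`. -/
theorem apply_eq_zero_iff_of_linearIndependent_iff (hι : 3 ≤ Fintype.card ι)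
    {G : (ι → K) → ι → K}
    (hG : ∀ v : ι → ι → K, LinearIndependent K (G ∘ v) ↔ LinearIndependent K v)
    (hGs : ∀ i, ∃ c : K, c ≠ 0 ∧ G (Pi.single i 1) = c • Pi.single i 1) (x : ι → K) (i : ι) :
    G x i = 0 ↔ x i = 0 := by
  obtain ⟨j, hji, -⟩ := exists_ne_and_ne_of_three_le_card hι i i
  obtain ⟨c, hc, hGj⟩ := hGs j
  have := minor_eq_iff_of_linearIndependent_iff hι hG hGs hji.symm x (Pi.single j 1)
  rw [hGj] at this
  simpa [hji.symm, hc] using this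

/-- The fundamental theorem of projective geometry for a map `G` of `K ^ ι` normalized by
`G 1 = 1`. -/
theorem exists_ringEquiv_of_linearIndependent_iff_of_apply_one (hι : 3 ≤ Fintype.card ι)
    {G : (ι → K) → ι → K}
    (hG : ∀ v : ι → ι → K, LinearIndependent K (G ∘ v) ↔ LinearIndependent K v)
    (hGs : ∀ i, ∃ c : K, c ≠ 0 ∧ G (Pi.single i 1) = c • Pi.single i 1) (hG1 : G 1 = 1)
    (hsurj : ∀ y, y ≠ 0 → ∃ x, ∃ c : K, c ≠ 0 ∧ G x = c • y) :
    ∃ f : K ≃+* K, ∀ x, x ≠ 0 → ∃ c : K, c ≠ 0 ∧ ∀ i, G x i = c * f (x i) := by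
  have third := exists_ne_and_ne_of_three_le_card hι
  have det3 := fun {i j k : ι} => det_three_eq_zero_iff_of_linearIndependent_iff hG hGs
    (i := i) (j := j) (k := k)
  have minor := fun {i j : ι} => minor_eq_iff_of_linearIndependent_iff hι hG hGs (i := i) (j := j)
  have zero_iff := apply_eq_zero_iff_of_linearIndependent_iff hι hG hGs
  -- `F i j` is the map induced by `G` on the ratio of coordinate j to coordinate i. It will turn
  -- out not to depend on i and j, and to be the automorphism sought.
  set F : ι → ι → K → K := fun i j t =>
    G (Pi.single i 1 + Pi.single j t) j / G (Pi.single i 1 + Pi.single j t) i with hF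
  have ratio : ∀ {i j : ι}, i ≠ j → ∀ x : ι → K, x i ≠ 0 → G x j = G x i * F i j (x j / x i) := by
    intro i j hij x hx
    set y : ι → K := Pi.single i 1 + Pi.single j (x j / x i) with hy
    have hyi : y i = 1 := by simp [hy, hij]
    have hyj : y j = x j / x i := by simp [hy, hij.symm]
    have h := (minor hij x y).2 (by rw [hyi, hyj]; field_simp)
    have hyi' : G y i ≠ 0 := by rw [ne_eq, zero_iff, hyi]; exact one_ne_zero
    change _ = _ * (G y j / G y i)
    rw [← mul_div_assoc, h, mul_div_cancel_right₀ _ hyi']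
  have F_one : ∀ {i j : ι}, i ≠ j → F i j 1 = 1 := by
    intro i j hij
    simpa [hG1] using (ratio hij 1 (by simp)).symm
  have F_zero : ∀ {i j : ι}, i ≠ j → F i j 0 = 0 := by
    intro i j hij
    have : G (Pi.single i 1 + Pi.single j 0) j = 0 := by rw [zero_iff]; simp [hij.symm]
    simp only [hF, this, zero_div]
  -- The k-to-i ratio is the product of the k-to-j and j-to-i ratios. Setting t = 1 removes the
  -- dependence on the first index, s = 1 that on the second.
  have F_mul : ∀ {i j k : ι}, i ≠ j → i ≠ k → j ≠ k → ∀ s t : K, t ≠ 0 →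
      F i k (s * t) = F j k s * F i j t := by
    intro i j k hij hik hjk s t ht
    set x : ι → K := Pi.single i 1 + Pi.single j t + Pi.single k (s * t) with hx
    have xi : x i = 1 := by simp [hx, hij, hik]
    have xj : x j = t := by simp [hx, hij.symm, hjk]
    have xk : x k = s * t := by simp [hx, hik.symm, hjk.symm]
    have h0 : G x i ≠ 0 := by rw [ne_eq, zero_iff, xi]; exact one_ne_zero
    have h1 := ratio hik x (by rw [xi]; exact one_ne_zero)
    have h2 := ratio hij x (by rw [xi]; exact one_ne_zero)
    have h3 := ratio hjk x (by rwa [xj])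
    rw [xk, xi, div_one] at h1
    rw [xj, xi, div_one] at h2
    rw [xk, xj, mul_div_cancel_right₀ _ ht] at h3
    apply mul_left_cancel₀ h0
    rw [← h1, h3, h2]
    ring
  have F_row : ∀ {i j k : ι}, i ≠ j → i ≠ k → j ≠ k → F i k = F j k := by
    intro i j k hij hik hjk
    ext s
    simpa [F_one hij] using F_mul hij hik hjk s 1 one_ne_zero
  have F_col : ∀ {i j k : ι}, i ≠ j → i ≠ k → F i j = F i k := by
    intro i j k hij hik
    by_cases hjk : j = k
    · rw [hjk]
    ext t
    by_cases ht : t = 0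
    · rw [ht, F_zero hij, F_zero hik]
    simpa [F_one hjk] using (F_mul hij hik hjk 1 t ht).symm
  have F_eq : ∀ {i j i' j' : ι}, i ≠ j → i' ≠ j' → F i j = F i' j' := by
    intro i j i' j' hij hij'
    by_cases hi : i = i'
    · subst hi; exact F_col hij hij'
    obtain ⟨k, hki, hki'⟩ := third i i'
    rw [F_col hij hki.symm, F_row hi hki.symm hki'.symm, F_col hki'.symm hij']
  obtain ⟨i₀⟩ : Nonempty ι := Fintype.card_pos_iff.1 (by omega)
  obtain ⟨j₀, hj₀, -⟩ := third i₀ i₀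
  obtain ⟨k₀, hki₀, hkj₀⟩ := third i₀ j₀
  set f := F i₀ j₀ with hf
  have ratio' : ∀ {i j : ι}, i ≠ j → ∀ x : ι → K, x i ≠ 0 → G x j = G x i * f (x j / x i) := by
    intro i j hij x hx
    rw [ratio hij x hx, F_eq hij hj₀.symm]
  have f_mul : ∀ s t, f (s * t) = f s * f t := by
    intro s t
    by_cases ht : t = 0
    · simp [ht, hf, F_zero hj₀.symm]
    have := F_mul hj₀.symm hki₀.symm hkj₀.symm s t ht
    rwa [F_eq hki₀.symm hj₀.symm, F_eq hkj₀.symm hj₀.symm] at this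
  have f_add : ∀ a b, f (a + b) = f a + f b := by
    intro a b
    -- Since z = x + y, the minor of x, y, z vanishes; the vanishing of the image minor is exactly
    -- additivity of f.
    set x : ι → K := Pi.single i₀ 1 + Pi.single k₀ a with hx
    set y : ι → K := Pi.single j₀ 1 + Pi.single k₀ b with hy
    set z : ι → K := Pi.single i₀ 1 + Pi.single j₀ 1 + Pi.single k₀ (a + b) with hz
    have xi : x i₀ = 1 := by simp [hx, hki₀.symm]
    have xj : x j₀ = 0 := by simp [hx, hj₀, hkj₀.symm]
    have xk : x k₀ = a := by simp [hx, hki₀]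
    have yi : y i₀ = 0 := by simp [hy, hj₀.symm, hki₀.symm]
    have yj : y j₀ = 1 := by simp [hy, hkj₀.symm]
    have yk : y k₀ = b := by simp [hy, hkj₀]
    have zi : z i₀ = 1 := by simp [hz, hj₀.symm, hki₀.symm]
    have zj : z j₀ = 1 := by simp [hz, hj₀, hkj₀.symm]
    have zk : z k₀ = a + b := by simp [hz, hki₀, hkj₀]
    have h := (det3 hj₀.symm hki₀.symm hkj₀.symm x y z).2 (by
      rw [xi, xj, xk, yi, yj, yk, zi, zj, zk, Matrix.det_fin_three]
      simp)
    have one : f 1 = 1 := F_one hj₀.symm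
    have Gxi : G x i₀ ≠ 0 := by rw [ne_eq, zero_iff, xi]; exact one_ne_zero
    have Gyj : G y j₀ ≠ 0 := by rw [ne_eq, zero_iff, yj]; exact one_ne_zero
    have Gzi : G z i₀ ≠ 0 := by rw [ne_eq, zero_iff, zi]; exact one_ne_zero
    rw [(zero_iff x j₀).2 xj, (zero_iff y i₀).2 yi,
      ratio' hki₀.symm x (by simp [xi]), ratio' hkj₀.symm y (by simp [yj]),
      ratio' hki₀.symm z (by simp [zi]), ratio' hj₀.symm z (by simp [zi]),
      xi, xk, yj, yk, zi, zj, zk, Matrix.det_fin_three] at h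
    simp [one] at h
    have : G x i₀ * G y j₀ * G z i₀ * (f (a + b) - (f a + f b)) = 0 := by linear_combination h
    simpa [Gxi, Gyj, Gzi, sub_eq_zero] using this
  let φ : K →+* K :=
    { toFun := f
      map_one' := F_one hj₀.symm
      map_mul' := f_mul
      map_zero' := F_zero hj₀.symm
      map_add' := f_add }
  have hφ : Function.Bijective φ := by
    refine ⟨φ.injective, fun t => ?_⟩
    -- A vector sent to the line of this y has a coordinate ratio whose image under f is t.
    set y : ι → K := Pi.single i₀ 1 + Pi.single j₀ t with hy
    have yi : y i₀ = 1 := by simp [hy, hj₀.symm]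
    have yj : y j₀ = t := by simp [hy, hj₀]
    obtain ⟨x, c, hc, hx⟩ := hsurj y fun h => by simp [h] at yi
    have hxi : G x i₀ = c := by simp [hx, yi]
    have hxj : G x j₀ = c * t := by simp [hx, yj]
    have h := ratio' hj₀.symm x (by rwa [ne_eq, ← zero_iff, hxi])
    rw [hxi, hxj] at h
    exact ⟨_, (mul_left_cancel₀ hc h).symm⟩
  refine ⟨RingEquiv.ofBijective φ hφ, fun x hx => ?_⟩
  obtain ⟨i, hi⟩ := Function.ne_iff.1 hx
  have hφi : φ (x i) ≠ 0 := by simpa using hi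
  refine ⟨G x i / φ (x i), div_ne_zero (by rwa [ne_eq, zero_iff]) hφi, fun j => ?_⟩
  change G x j = _ / _ * φ (x j)
  by_cases hij : i = j
  · rw [← hij, div_mul_cancel₀ _ hφi]
  · rw [ratio' hij x hi]
    change _ * φ _ = _
    rw [map_div₀]
    ring

/-- The fundamental theorem of projective geometry in coordinates: a map of `K ^ ι` which preserves
and reflects linear independence of `ι`-indexed families, is surjective up to scalars, and fixes the
standard basis vectors up to scalars acts, up to scalars, by a field automorphism applied to the
coordinates followed by a diagonal map. -/
theorem exists_ringEquiv_of_linearIndependent_iff (hι : 3 ≤ Fintype.card ι)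
    {G : (ι → K) → ι → K}
    (hG : ∀ v : ι → ι → K, LinearIndependent K (G ∘ v) ↔ LinearIndependent K v)
    (hGs : ∀ i, ∃ c : K, c ≠ 0 ∧ G (Pi.single i 1) = c • Pi.single i 1)
    (hsurj : ∀ y, y ≠ 0 → ∃ x, ∃ c : K, c ≠ 0 ∧ G x = c • y) :
    ∃ (d : ι → Kˣ) (f : K ≃+* K), ∀ x, x ≠ 0 →
      ∃ c : K, c ≠ 0 ∧ ∀ i, G x i = c * (d i * f (x i)) := by
  have hd : ∀ i, G 1 i ≠ 0 := fun i => by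
    rw [ne_eq, apply_eq_zero_iff_of_linearIndependent_iff hι hG hGs]
    exact one_ne_zero
  set d : ι → Kˣ := fun i => Units.mk0 (G 1 i) (hd i)
  -- Dividing by the coordinates of `G 1` reduces to the normalized case.
  set D : (ι → K) ≃ₗ[K] (ι → K) := LinearEquiv.piCongrRight fun i =>
    LinearEquiv.smulOfUnit (d i)⁻¹ with hD
  have hDi : ∀ y i, D y i = (G 1 i)⁻¹ * y i := fun y i => rfl
  obtain ⟨f, hf⟩ := exists_ringEquiv_of_linearIndependent_iff_of_apply_one hι (G := D ∘ G)
    (fun v => by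
      rw [← hG v]
      exact LinearMap.linearIndependent_iff (v := G ∘ v) D.toLinearMap D.ker)
    (fun i => by
      obtain ⟨c, hc, h⟩ := hGs i
      refine ⟨(G 1 i)⁻¹ * c, mul_ne_zero (inv_ne_zero (hd i)) hc, ?_⟩
      ext j
      rw [Function.comp_apply, hDi, h]
      by_cases hij : i = j
      · subst hij; simp
      · simp [Ne.symm hij])
    (by
      ext i
      rw [Function.comp_apply, hDi, inv_mul_cancel₀ (hd i), Pi.one_apply])
    (fun y hy => by
      obtain ⟨x, c, hc, h⟩ := hsurj (D.symm y) (by simpa using hy)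
      exact ⟨x, c, hc, by rw [Function.comp_apply, h, map_smul, D.apply_symm_apply]⟩)
  refine ⟨d, f, fun x hx => ?_⟩
  obtain ⟨c, hc, h⟩ := hf x hx
  refine ⟨c, hc, fun i => ?_⟩
  have := h i
  rw [Function.comp_apply, hDi, inv_mul_eq_iff_eq_mul₀ (hd i)] at this
  rw [this]
  change _ = c * (G 1 i * _)
  ring

end Coordinates

/-! ### Recovering the order from spanning pairs. -/

/-- For the converse, let c be a complement of a ⊔ b. Then b ⊔ c joins with a to the top, so b ⊔ c
is itself the top, and modularity forces b = a ⊔ b. -/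
theorem le_iff_forall_sup_eq_top {L : Type*} [Lattice L] [BoundedOrder L] [IsModularLattice L]
    [ComplementedLattice L] {a b : L} : a ≤ b ↔ ∀ c, a ⊔ c = ⊤ → b ⊔ c = ⊤ := by
  refine ⟨fun h c hc => top_le_iff.1 (hc.ge.trans (sup_le_sup_right h c)), fun h => ?_⟩
  obtain ⟨c, hc⟩ := exists_isCompl (a ⊔ b)
  have hbc : b ⊔ c = ⊤ := by
    have := h (b ⊔ c) (by rw [← sup_assoc, hc.sup_eq_top])
    rwa [← sup_assoc, sup_idem] at this
  have : b = a ⊔ b := eq_of_le_of_inf_le_of_sup_le (z := c) le_sup_right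
    (by rw [hc.inf_eq_bot]; exact bot_le) (by rw [hbc]; exact le_top)
  rw [this]
  exact le_sup_left

/-- A surjection between complemented modular lattices which preserves and reflects spanning pairs
is an order isomorphism. -/
theorem exists_orderIso_of_sup_eq_top_iff {L M : Type*} [Lattice L] [BoundedOrder L]
    [IsModularLattice L] [ComplementedLattice L] [Lattice M] [BoundedOrder M] [IsModularLattice M]
    [ComplementedLattice M] {e : L → M} (he : Function.Surjective e)
    (h : ∀ a b, e a ⊔ e b = ⊤ ↔ a ⊔ b = ⊤) : ∃ E : L ≃o M, ∀ a, E a = e a := by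
  have hle : ∀ a b, e a ≤ e b ↔ a ≤ b := fun a b => by
    rw [le_iff_forall_sup_eq_top, le_iff_forall_sup_eq_top, he.forall]
    simp only [h]
  exact ⟨RelIso.ofSurjective (OrderEmbedding.ofMapLEIff e hle) he, fun _ => rfl⟩

theorem linearIndependent_iff_iSup_span_singleton_eq_top {K V ι : Type*} [DivisionRing K]
    [AddCommGroup V] [Module K V] [FiniteDimensional K V] [Fintype ι]
    (hι : Fintype.card ι = Module.finrank K V) (v : ι → V) :
    LinearIndependent K v ↔ ⨆ i, Submodule.span K {v i} = ⊤ := by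
  rw [← Submodule.span_range_eq_iSup]
  exact ⟨fun h => h.span_eq_top_of_card_eq_finrank' hι,
    fun h => linearIndependent_of_top_le_span_of_card_eq_finrank h.ge hι⟩

/-! ### Invertibility of combinations of projections. -/

section Hilbert

variable {H : Type*} [NormedAddCommGroup H] [InnerProductSpace ℂ H] [CompleteSpace H]

namespace IsStarProjection

variable {P : H →L[ℂ] H}

theorem inner_apply_eq_of_mem_range (hP : IsStarProjection P) {y : H}
    (hy : y ∈ (P : H →ₗ[ℂ] H).range) (x : H) : inner ℂ y (P x) = inner ℂ y x := by
  obtain ⟨_, h⟩ := isStarProjection_iff_eq_starProjection_range.1 hP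
  rw [h, ← Submodule.inner_starProjection_left_eq_right, Submodule.starProjection_eq_self_iff.2 hy]

theorem apply_eq_self_of_mem_range (hP : IsStarProjection P) {y : H}
    (hy : y ∈ (P : H →ₗ[ℂ] H).range) : P y = y := by
  obtain ⟨_, h⟩ := isStarProjection_iff_eq_starProjection_range.1 hP
  rw [h, Submodule.starProjection_eq_self_iff.2 hy]

end IsStarProjection

/-- The kernel of an orthogonal projection is orthogonal to its range, so x is orthogonal to a
spanning set. -/
theorem eq_zero_of_iSup_range_eq_top {ι : Type*} {P : ι → H →L[ℂ] H}
    (hP : ∀ i, IsStarProjection (P i)) (htop : ⨆ i, (P i : H →ₗ[ℂ] H).range = ⊤) {x : H}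
    (hx : ∀ i, P i x = 0) : x = 0 := by
  have : (⊤ : Submodule ℂ H) ≤ (ℂ ∙ x)ᗮ := by
    rw [← htop]
    refine iSup_le fun i y hy => ?_
    rw [Submodule.mem_orthogonal_singleton_iff_inner_left,
      ← (hP i).inner_apply_eq_of_mem_range hy, hx i, inner_zero_right]
  exact inner_self_eq_zero.1 <|
    (Submodule.mem_orthogonal_singleton_iff_inner_left (𝕜 := ℂ)).1 (this (Submodule.mem_top (x := x)))

theorem ContinuousLinearMap.isUnit_iff_forall_apply_eq_zero [FiniteDimensional ℂ H]
    {T : H →L[ℂ] H} : IsUnit T ↔ ∀ x, T x = 0 → x = 0 := by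
  rw [ContinuousLinearMap.isUnit_iff_isUnit_toLinearMap, LinearMap.isUnit_iff_ker_eq_bot,
    LinearMap.ker_eq_bot']
  rfl

/-- Every condition on the right is invariant under order isomorphisms of the subspace lattice. If a
and b are nonzero and aPx + bQx = 0, then Px lies in both ranges, and evaluating ⟨Px, x⟩ through P
and through Q gives (a + b)‖Px‖² = 0. -/
theorem isUnit_smul_add_smul_iff [FiniteDimensional ℂ H] {P Q : H →L[ℂ] H}
    (hP : IsStarProjection P) (hQ : IsStarProjection Q) (a b : ℂ) :
    IsUnit (a • P + b • Q) ↔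
      (P : H →ₗ[ℂ] H).range ⊔ (Q : H →ₗ[ℂ] H).range = ⊤ ∧
      (a = 0 → (Q : H →ₗ[ℂ] H).range = ⊤) ∧ (b = 0 → (P : H →ₗ[ℂ] H).range = ⊤) ∧
      (a + b = 0 → (P : H →ₗ[ℂ] H).range ⊓ (Q : H →ₗ[ℂ] H).range = ⊥) := by
  have hPr : ∀ x, P x ∈ (P : H →ₗ[ℂ] H).range := fun x => ⟨x, rfl⟩
  have hQr : ∀ x, Q x ∈ (Q : H →ₗ[ℂ] H).range := fun x => ⟨x, rfl⟩
  constructor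
  · intro h
    have hsurj := (ContinuousLinearMap.isUnit_iff_bijective.1 h).2
    have hinj := ContinuousLinearMap.isUnit_iff_forall_apply_eq_zero.1 h
    refine ⟨?_, ?_, ?_, ?_⟩
    · refine top_le_iff.1 fun y _ => ?_
      obtain ⟨x, rfl⟩ := hsurj y
      exact Submodule.add_mem_sup (Submodule.smul_mem _ _ (hPr x)) (Submodule.smul_mem _ _ (hQr x))
    · rintro rfl
      refine top_le_iff.1 fun y _ => ?_
      obtain ⟨x, rfl⟩ := hsurj y
      simpa using Submodule.smul_mem _ b (hQr x)
    · rintro rfl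
      refine top_le_iff.1 fun y _ => ?_
      obtain ⟨x, rfl⟩ := hsurj y
      simpa using Submodule.smul_mem _ a (hPr x)
    · intro hab
      refine (Submodule.eq_bot_iff _).2 fun z hz => hinj z ?_
      simp [hP.apply_eq_self_of_mem_range hz.1, hQ.apply_eq_self_of_mem_range hz.2, ← add_smul, hab]
  · rintro ⟨hsup, ha, hb, hab⟩
    refine ContinuousLinearMap.isUnit_iff_forall_apply_eq_zero.2 fun x hx => ?_
    replace hx : a • P x + b • Q x = 0 := hx
    by_cases ha0 : a = 0
    · have hxQ : x ∈ (Q : H →ₗ[ℂ] H).range := by rw [ha ha0]; trivial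
      by_cases hb0 : b = 0
      · have hxP : x ∈ (P : H →ₗ[ℂ] H).range := by rw [hb hb0]; trivial
        exact (Submodule.eq_bot_iff _).1 (hab (by simp [ha0, hb0])) x ⟨hxP, hxQ⟩
      · rw [hQ.apply_eq_self_of_mem_range hxQ] at hx
        simpa [ha0, hb0] using hx
    by_cases hb0 : b = 0
    · have hxP : x ∈ (P : H →ₗ[ℂ] H).range := by rw [hb hb0]; trivial
      rw [hP.apply_eq_self_of_mem_range hxP] at hx
      simpa [ha0, hb0] using hx
    have hq : Q x = (-(b⁻¹ * a)) • P x := by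
      rw [neg_smul, mul_smul, ← smul_neg, ← eq_neg_of_add_eq_zero_right hx, smul_smul,
        inv_mul_cancel₀ hb0, one_smul]
    have hp : P x = (-(a⁻¹ * b)) • Q x := by
      rw [neg_smul, mul_smul, ← smul_neg, ← eq_neg_of_add_eq_zero_left hx, smul_smul,
        inv_mul_cancel₀ ha0, one_smul]
    have hpQ : P x ∈ (Q : H →ₗ[ℂ] H).range := by
      rw [hp]; exact Submodule.smul_mem _ _ (hQr x)
    have hp0 : P x = 0 := by
      by_cases hs : a + b = 0
      · exact (Submodule.eq_bot_iff _).1 (hab hs) _ ⟨hPr x, hpQ⟩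
      · have h1 := hP.inner_apply_eq_of_mem_range (hPr x) x
        have h2 := hQ.inner_apply_eq_of_mem_range hpQ x
        rw [← h1, hq, inner_smul_right] at h2
        rw [← inner_self_eq_zero (𝕜 := ℂ)]
        have : (a + b) * inner ℂ (P x) (P x) = 0 := by
          field_simp at h2
          linear_combination -h2
        exact (mul_eq_zero.1 this).resolve_left hs
    refine eq_zero_of_iSup_range_eq_top (P := fun i : Bool => cond i P Q) ?_ ?_ ?_
    · rintro (_ | _) <;> assumption
    · rw [iSup_bool_eq]; exact hsup
    · rintro (_ | _)
      · simpa [hp0] using hq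
      · exact hp0

theorem exists_range_eq_span_singleton {P : H →L[ℂ] H} (hP : P ∈ rankOneProjections H) :
    ∃ v : H, v ≠ 0 ∧ (P : H →ₗ[ℂ] H).range = ℂ ∙ v := by
  obtain ⟨v, hv0, hv⟩ := finrank_eq_one_iff'.1 hP.2
  refine ⟨v, by simpa using hv0, le_antisymm (fun w hw => ?_) ?_⟩
  · obtain ⟨c, hc⟩ := hv ⟨w, hw⟩
    exact Submodule.mem_span_singleton.2 ⟨c, congrArg Subtype.val hc⟩
  · exact (Submodule.span_singleton_le_iff_mem _ _).2 v.2

/-- If the lines span, their generators are independent, so a vanishing combination forces every `P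
i x` to vanish, hence x as well. -/
theorem isUnit_sum_smul_iff [FiniteDimensional ℂ H] {ι : Type*} [Fintype ι]
    (hι : Fintype.card ι = Module.finrank ℂ H) {P : ι → H →L[ℂ] H}
    (hP : ∀ i, P i ∈ rankOneProjections H) (c : ι → ℂ) :
    IsUnit (∑ i, c i • P i) ↔ (∀ i, c i ≠ 0) ∧ ⨆ i, (P i : H →ₗ[ℂ] H).range = ⊤ := by
  choose v hv0 hv using fun i => exists_range_eq_span_singleton (hP i)
  have hPv : ∀ i x, ∃ t : ℂ, t • v i = P i x := fun i x =>
    Submodule.mem_span_singleton.1 (by rw [← hv i]; exact ⟨x, rfl⟩)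
  constructor
  · intro h
    have hc : LinearIndependent ℂ fun i => c i • v i := by
      refine linearIndependent_of_top_le_span_of_card_eq_finrank (fun y _ => ?_) hι
      obtain ⟨x, rfl⟩ := (ContinuousLinearMap.isUnit_iff_bijective.1 h).2 y
      rw [sum_apply]
      refine Submodule.sum_mem _ fun i _ => ?_
      obtain ⟨t, ht⟩ := hPv i x
      rw [smul_apply, ← ht, smul_comm]
      exact Submodule.smul_mem _ _ (Submodule.subset_span ⟨i, rfl⟩)
    have hc0 : ∀ i, c i ≠ 0 := fun i hi => hc.ne_zero i (by simp [hi])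
    refine ⟨hc0, ?_⟩
    rw [linearIndependent_iff_iSup_span_singleton_eq_top hι] at hc
    rw [← hc]
    exact iSup_congr fun i => by
      rw [hv i, Submodule.span_singleton_smul_eq (isUnit_iff_ne_zero.2 (hc0 i))]
  · rintro ⟨hc, htop⟩
    have hli : LinearIndependent ℂ v := by
      rw [linearIndependent_iff_iSup_span_singleton_eq_top hι, ← htop]
      exact iSup_congr fun i => (hv i).symm
    refine ContinuousLinearMap.isUnit_iff_forall_apply_eq_zero.2 fun x hx =>
      eq_zero_of_iSup_range_eq_top (fun i => (hP i).1) htop fun i => ?_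
    choose t ht using fun i => hPv i x
    have h0 : ∑ i, (c i * t i) • v i = 0 := by
      rw [← hx, sum_apply]
      exact Finset.sum_congr rfl fun i _ => by
        rw [smul_apply, mul_smul, ht]
    have := Fintype.linearIndependent_iff.1 hli _ h0 i
    rw [← ht i, (mul_eq_zero.1 this).resolve_left (hc i), zero_smul]

/-- A map of rank one projections preserves the joint spectrum of `dim H` members iff it preserves and
reflect spanning of the ranges. -/
theorem preservesJointSpectrum_finrank_iff [FiniteDimensional ℂ H] {n : ℕ}
    (hdim : Module.finrank ℂ H = n) (φ : rankOneProjections H → rankOneProjections H) :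
    PreservesJointSpectrum n φ ↔ ∀ P : Fin n → rankOneProjections H,
      ⨆ i, ((φ (P i) : H →L[ℂ] H) : H →ₗ[ℂ] H).range = ⊤ ↔
        ⨆ i, ((P i : H →L[ℂ] H) : H →ₗ[ℂ] H).range = ⊤ := by
  have hι : Fintype.card (Fin n) = Module.finrank ℂ H := by simp [hdim]
  have key := fun (P : Fin n → rankOneProjections H) c =>
    isUnit_sum_smul_iff hι (fun i => (P i).2) c
  refine forall_congr' fun P => ?_
  simp only [jointSpectrum, Set.ext_iff, Set.mem_ofPred_eq, not_iff_not]
  constructor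
  · intro h
    -- The all-ones coefficients satisfy the nonvanishing condition, leaving only spanning.
    have := h 1
    rw [key fun i => φ (P i), key P] at this
    simpa using this
  · intro h c
    rw [key fun i => φ (P i), key P, h]

/-- An orthogonal projection is determined by its range, which can be any subspace. -/
noncomputable def projectionsEquivSubmodule [FiniteDimensional ℂ H] :
    projections H ≃ Submodule ℂ H where
  toFun P := ((P : H →L[ℂ] H) : H →ₗ[ℂ] H).range
  invFun K := ⟨K.starProjection, isStarProjection_starProjection⟩
  left_inv P := by
    obtain ⟨_, h⟩ := isStarProjection_iff_eq_starProjection_range.1 P.2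
    exact Subtype.ext h.symm
  right_inv K := Submodule.range_starProjection K

/-- A map on projections that comes from an order isomorphism of subspaces preserves the joint
spectrum of any two projections. -/
theorem preservesJointSpectrum_two_of_orderIso [FiniteDimensional ℂ H]
    {Φ : projections H → projections H} (E : Submodule ℂ H ≃o Submodule ℂ H)
    (hE : ∀ P, ((Φ P : H →L[ℂ] H) : H →ₗ[ℂ] H).range = E ((P : H →L[ℂ] H) : H →ₗ[ℂ] H).range) :
    PreservesJointSpectrum 2 Φ := by
  intro P
  simp only [jointSpectrum, Set.ext_iff, Set.mem_ofPred_eq, not_iff_not, Fin.sum_univ_two]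
  intro c
  rw [isUnit_smul_add_smul_iff (Φ (P 0)).2 (Φ (P 1)).2, isUnit_smul_add_smul_iff (P 0).2 (P 1).2,
    hE, hE, ← map_sup, ← map_inf, map_eq_top_iff, map_eq_top_iff, map_eq_top_iff, map_eq_bot_iff]

/-- With coefficients 1 and 1, none of a, b, a + b is zero, so invertibility just says that the two
ranges span. -/
theorem exists_orderIso_of_preservesJointSpectrum_two [FiniteDimensional ℂ H]
    {Φ : projections H → projections H} (hΦ : Function.Surjective Φ)
    (h : PreservesJointSpectrum 2 Φ) :
    ∃ E : Submodule ℂ H ≃o Submodule ℂ H, ∀ P, ((Φ P : H →L[ℂ] H) : H →ₗ[ℂ] H).range =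
      E ((P : H →L[ℂ] H) : H →ₗ[ℂ] H).range := by
  have hsup : ∀ P Q : projections H,
      ((Φ P : H →L[ℂ] H) : H →ₗ[ℂ] H).range ⊔ ((Φ Q : H →L[ℂ] H) : H →ₗ[ℂ] H).range = ⊤ ↔
      ((P : H →L[ℂ] H) : H →ₗ[ℂ] H).range ⊔ ((Q : H →L[ℂ] H) : H →ₗ[ℂ] H).range = ⊤ := by
    intro P Q
    have key := fun P Q : projections H => isUnit_smul_add_smul_iff P.2 Q.2 1 1
    have h1 := congrArg (![1, 1] ∈ ·) (h ![P, Q])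
    simp only [jointSpectrum, Set.mem_ofPred_eq, Fin.sum_univ_two, eq_iff_iff, not_iff_not] at h1
    simp only [Matrix.cons_val_zero, Matrix.cons_val_one, key] at h1
    norm_num at h1
    exact h1
  obtain ⟨E, hE⟩ := exists_orderIso_of_sup_eq_top_iff
    (e := projectionsEquivSubmodule ∘ Φ ∘ projectionsEquivSubmodule.symm)
    (projectionsEquivSubmodule.surjective.comp (hΦ.comp projectionsEquivSubmodule.symm.surjective))
    (fun M N => by
      obtain ⟨P, rfl⟩ := projectionsEquivSubmodule.surjective M
      obtain ⟨Q, rfl⟩ := projectionsEquivSubmodule.surjective N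
      simp only [Function.comp_apply, Equiv.symm_apply_apply]
      exact hsup P Q)
  refine ⟨E, fun P => ?_⟩
  have := hE (projectionsEquivSubmodule P)
  simp only [Function.comp_apply, Equiv.symm_apply_apply] at this
  exact this.symm

end Hilbert

/-! ### Semilinear maps and lines. -/

section Main

variable {H : Type*} [NormedAddCommGroup H] [InnerProductSpace ℂ H] {n : ℕ}

/-- The map induced by an orthonormal basis, a basis and a ring automorphism, as a semilinear
map. -/
noncomputable def inducedLinearMap (α : OrthonormalBasis (Fin n) ℂ H)
    (β : Module.Basis (Fin n) ℂ H) (f : ℂ ≃+* ℂ) : H →ₛₗ[(f : ℂ →+* ℂ)] H where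
  toFun := inducedMap α β f
  map_add' x y := by simp [inducedMap, add_smul, Finset.sum_add_distrib]
  map_smul' c x := by simp [inducedMap, Finset.smul_sum, mul_smul]

theorem inducedLinearMap_bijective (α : OrthonormalBasis (Fin n) ℂ H)
    (β : Module.Basis (Fin n) ℂ H) (f : ℂ ≃+* ℂ) :
    Function.Bijective (inducedLinearMap α β f) := by
  constructor
  · refine (injective_iff_map_eq_zero _).2 fun x hx => ?_
    have h := Fintype.linearIndependent_iff.1 β.linearIndependent _ hx
    refine α.repr.injective ?_
    ext i
    simpa using h i
  · intro y
    refine ⟨α.repr.symm (WithLp.toLp 2 fun i => f.symm (β.repr y i)), ?_⟩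
    simp [inducedLinearMap, inducedMap, β.sum_repr y]

/-- The order isomorphism of the lattice of subspaces given by the induced semilinear map. -/
noncomputable def inducedOrderIso (α : OrthonormalBasis (Fin n) ℂ H)
    (β : Module.Basis (Fin n) ℂ H) (f : ℂ ≃+* ℂ) : Submodule ℂ H ≃o Submodule ℂ H :=
  Submodule.orderIsoMapComapOfBijective (inducedLinearMap α β f)
    (inducedLinearMap_bijective α β f)

theorem inducedOrderIso_span_singleton (α : OrthonormalBasis (Fin n) ℂ H)
    (β : Module.Basis (Fin n) ℂ H) (f : ℂ ≃+* ℂ) (x : H) :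
    inducedOrderIso α β f (ℂ ∙ x) = ℂ ∙ inducedMap α β f x := by
  change (ℂ ∙ x).map (inducedLinearMap α β f) = _
  rw [Submodule.map_span, Set.image_singleton]
  rfl

theorem range_eq_setOf_inducedMap_iff (α : OrthonormalBasis (Fin n) ℂ H)
    (β : Module.Basis (Fin n) ℂ H) (f : ℂ ≃+* ℂ) (P Q : H →L[ℂ] H) :
    Set.range Q = {y : H | ∃ ξ : H, y = inducedMap α β f (P ξ)} ↔
      (Q : H →ₗ[ℂ] H).range = inducedOrderIso α β f (P : H →ₗ[ℂ] H).range := by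
  have h1 : ((Q : H →ₗ[ℂ] H).range : Set H) = Set.range Q := rfl
  have h2 : (inducedOrderIso α β f (P : H →ₗ[ℂ] H).range : Set H) =
      {y : H | ∃ ξ : H, y = inducedMap α β f (P ξ)} := by
    ext y
    constructor
    · rintro ⟨_, ⟨ξ, rfl⟩, rfl⟩
      exact ⟨ξ, rfl⟩
    · rintro ⟨ξ, rfl⟩
      exact ⟨_, ⟨ξ, rfl⟩, rfl⟩
  rw [← h1, ← h2, SetLike.coe_set_eq]

variable [CompleteSpace H]

/-- The rank one projection onto the line spanned by a nonzero vector. -/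
noncomputable def lineProjection (v : H) (hv : v ≠ 0) : rankOneProjections H :=
  ⟨(ℂ ∙ v).starProjection, isStarProjection_starProjection, by
    rw [Submodule.range_starProjection, finrank_span_singleton hv]⟩

theorem range_lineProjection (v : H) (hv : v ≠ 0) :
    ((lineProjection v hv : H →L[ℂ] H) : H →ₗ[ℂ] H).range = ℂ ∙ v :=
  Submodule.range_starProjection _

theorem exists_eq_lineProjection (P : rankOneProjections H) :
    ∃ v hv, P = lineProjection v hv := by
  obtain ⟨v, hv0, hv⟩ := exists_range_eq_span_singleton P.2
  refine ⟨v, hv0, Subtype.ext ?_⟩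
  rw [ContinuousLinearMap.IsStarProjection.ext_iff P.2.1 (lineProjection v hv0).2.1, hv,
    range_lineProjection]

variable [FiniteDimensional ℂ H]

/-- A map of rank one projections that preserves and reflects spanning of the ranges of `n`-tuples
lifts to a map of vectors that preserves and reflects linear independence. -/
theorem exists_vector_map (hdim : Module.finrank ℂ H = n)
    (φ : rankOneProjections H → rankOneProjections H)
    (h : ∀ P : Fin n → rankOneProjections H,
      ⨆ i, ((φ (P i) : H →L[ℂ] H) : H →ₗ[ℂ] H).range = ⊤ ↔
        ⨆ i, ((P i : H →L[ℂ] H) : H →ₗ[ℂ] H).range = ⊤) :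
    ∃ g : H → H, (∀ v hv, ((φ (lineProjection v hv) : H →L[ℂ] H) : H →ₗ[ℂ] H).range = ℂ ∙ g v) ∧
      ∀ v : Fin n → H, LinearIndependent ℂ (g ∘ v) ↔ LinearIndependent ℂ v := by
  have hι : Fintype.card (Fin n) = Module.finrank ℂ H := by simp [hdim]
  -- Zero is sent to zero so that families containing the zero vector are dependent on both sides.
  have : ∀ v : H, ∃ w : H, (v = 0 → w = 0) ∧
      ∀ hv, ((φ (lineProjection v hv) : H →L[ℂ] H) : H →ₗ[ℂ] H).range = ℂ ∙ w := by
    intro v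
    by_cases hv : v = 0
    · exact ⟨0, fun _ => rfl, fun hv' => absurd hv hv'⟩
    · obtain ⟨w, -, hw⟩ := exists_range_eq_span_singleton (φ (lineProjection v hv)).2
      exact ⟨w, fun hv' => absurd hv' hv, fun _ => hw⟩
  choose g hg0 hg using this
  refine ⟨g, hg, fun v => ?_⟩
  by_cases hv : ∀ i, v i ≠ 0
  · have := h fun i => lineProjection (v i) (hv i)
    simp only [hg, range_lineProjection] at this
    rw [linearIndependent_iff_iSup_span_singleton_eq_top hι,
      linearIndependent_iff_iSup_span_singleton_eq_top hι, ← this]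
    rfl
  · push Not at hv
    obtain ⟨i, hi⟩ := hv
    exact iff_of_false (fun hli => hli.ne_zero i (hg0 _ hi)) fun hli => hli.ne_zero i hi

/-- A surjective map of rank one projections that preserves and reflects spanning of the ranges of
`n`-tuples is induced by a semilinear map. -/
theorem exists_inducedOrderIso (hn : 3 ≤ n) (hdim : Module.finrank ℂ H = n)
    (φ : rankOneProjections H → rankOneProjections H) (hφ : Function.Surjective φ)
    (h : ∀ P : Fin n → rankOneProjections H,
      ⨆ i, ((φ (P i) : H →L[ℂ] H) : H →ₗ[ℂ] H).range = ⊤ ↔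
        ⨆ i, ((P i : H →L[ℂ] H) : H →ₗ[ℂ] H).range = ⊤) :
    ∃ (α : OrthonormalBasis (Fin n) ℂ H) (β : Module.Basis (Fin n) ℂ H) (f : ℂ ≃+* ℂ),
      ∀ P : rankOneProjections H, ((φ P : H →L[ℂ] H) : H →ₗ[ℂ] H).range =
        inducedOrderIso α β f ((P : H →L[ℂ] H) : H →ₗ[ℂ] H).range := by
  obtain ⟨g, hg, hli⟩ := exists_vector_map hdim φ h
  let α : OrthonormalBasis (Fin n) ℂ H := (stdOrthonormalBasis ℂ H).reindex (finCongr hdim)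
  let A : H ≃ₗ[ℂ] (Fin n → ℂ) := α.toBasis.equivFun
  have hA : ∀ x i, A x i = α.repr x i := fun x i => rfl
  -- Using the images of α as target basis makes the coordinate map fix the standard basis vectors.
  let b : Module.Basis (Fin n) ℂ H := basisOfLinearIndependentOfCardEqFinrank' (g ∘ α)
    ((hli α).2 α.orthonormal.linearIndependent) (by simp [hdim])
  let B : H ≃ₗ[ℂ] (Fin n → ℂ) := b.equivFun
  have hAs : ∀ i, A.symm (Pi.single i 1) = α i := fun i => by
    simp [A]
  have hB : ∀ i, B (g (α i)) = Pi.single i 1 := fun i => by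
    have hb : g (α i) = b i := by simp [b]
    ext j
    rw [hb, Module.Basis.equivFun_self, Pi.single_apply]
    simp only [eq_comm]
  obtain ⟨d, f, hf⟩ := exists_ringEquiv_of_linearIndependent_iff (by simpa using hn)
    (G := fun x => B (g (A.symm x)))
    (fun v => by
      rw [← LinearMap.linearIndependent_iff (v := v) A.symm.toLinearMap A.symm.ker, ← hli]
      exact LinearMap.linearIndependent_iff (v := g ∘ A.symm ∘ v) B.toLinearMap B.ker)
    (fun i => ⟨1, one_ne_zero, by rw [hAs, hB, one_smul]⟩)
    (fun y hy => by
      have hw : B.symm y ≠ 0 := by simpa using hy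
      obtain ⟨P, hP⟩ := hφ (lineProjection _ hw)
      obtain ⟨v, hv, rfl⟩ := exists_eq_lineProjection P
      have := hg v hv
      rw [hP, range_lineProjection, eq_comm, Submodule.span_singleton_eq_span_singleton] at this
      obtain ⟨c, hc⟩ := this
      refine ⟨A v, (c⁻¹ : ℂˣ), Units.ne_zero _, ?_⟩
      rw [A.symm_apply_apply, ← B.apply_symm_apply y, ← hc, Units.smul_def, map_smul,
        smul_smul, Units.inv_mul, one_smul])
  -- Rescaling the target basis by d absorbs the diagonal factor.
  refine ⟨α, b.unitsSMul d, f, fun P => ?_⟩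
  obtain ⟨v, hv, rfl⟩ := exists_eq_lineProjection P
  rw [hg, range_lineProjection, inducedOrderIso_span_singleton]
  obtain ⟨c, hc, hcv⟩ := hf (A v) (by simpa using hv)
  have : g v = c • inducedMap α (b.unitsSMul d) f v := by
    rw [← b.sum_equivFun (g v), inducedMap, Finset.smul_sum]
    refine Finset.sum_congr rfl fun i _ => ?_
    have := hcv i
    rw [A.symm_apply_apply, hA] at this
    change B (g v) i • _ = _
    rw [this, Module.Basis.unitsSMul_apply, Units.smul_def, smul_smul, smul_smul]
    congr 1
    ring
  rw [this, Submodule.span_singleton_smul_eq (isUnit_iff_ne_zero.2 hc)]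

end Main

/-! ### The equivalence. -/

theorem theorem1p3 {H : Type*} [NormedAddCommGroup H] [InnerProductSpace ℂ H] [CompleteSpace H]
    [FiniteDimensional ℂ H] (n : ℕ) (hn : 3 ≤ n) (hdim : Module.finrank ℂ H = n)
    (φ : rankOneProjections H → rankOneProjections H) (hφ : Function.Surjective φ) :
    List.TFAE [
      PreservesJointSpectrum n φ,
      ∃ (α : OrthonormalBasis (Fin n) ℂ H) (β : Module.Basis (Fin n) ℂ H) (f : ℂ ≃+* ℂ),
        ∀ P : rankOneProjections H,
          Set.range (φ P : H →L[ℂ] H) =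
            {y : H | ∃ ξ : H, y = inducedMap α β f ((P : H →L[ℂ] H) ξ)},
      ∃ Φ : projections H → projections H, Function.Surjective Φ ∧
        (∀ P : rankOneProjections H,
          (Φ ⟨(P : H →L[ℂ] H), P.2.1⟩ : H →L[ℂ] H) = (φ P : H →L[ℂ] H)) ∧
        PreservesJointSpectrum 2 Φ] := by
  simp only [range_eq_setOf_inducedMap_iff]
  tfae_have 1 → 2 := fun h =>
    exists_inducedOrderIso hn hdim φ hφ ((preservesJointSpectrum_finrank_iff hdim φ).1 h)
  tfae_have 2 → 3 := by
    rintro ⟨α, β, f, h⟩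
    let E := inducedOrderIso α β f
    let e := projectionsEquivSubmodule (H := H)
    have hΦ : ∀ P, e (e.symm (E (e P))) = E (e P) := fun P => e.apply_symm_apply _
    refine ⟨fun P => e.symm (E (e P)),
      e.symm.surjective.comp (E.surjective.comp e.surjective), fun P => ?_,
      preservesJointSpectrum_two_of_orderIso E hΦ⟩
    -- Both sides are orthogonal projections, so equal ranges suffice.
    exact ContinuousLinearMap.IsStarProjection.ext (e.symm (E (e ⟨P, P.2.1⟩))).2 (φ P).2.1
      ((hΦ ⟨P, P.2.1⟩).trans (h P).symm)
  tfae_have 3 → 1 := by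
    rintro ⟨Φ, hΦ, hext, hspec⟩
    obtain ⟨E, hE⟩ := exists_orderIso_of_preservesJointSpectrum_two hΦ hspec
    refine (preservesJointSpectrum_finrank_iff hdim φ).2 fun P => ?_
    have : ∀ i, ((φ (P i) : H →L[ℂ] H) : H →ₗ[ℂ] H).range =
        E ((P i : H →L[ℂ] H) : H →ₗ[ℂ] H).range := fun i => by
      rw [← hext (P i)]
      exact hE ⟨P i, (P i).2.1⟩
    simp only [this]
    rw [← map_iSup, map_eq_top_iff]
  tfae_finish
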